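/- Let $\mathbb K=\mathbb R$ or $\mathbb C$ and let $1\le h<n$ be integers. For a Hermitian matrix $B\in\mathbb K^{n\times n}$ let $\lambda_1(B)\ge\dots\ge\lambda_n(B)$ be its eigenvalues, counted with multiplicity, and call a subspace $\mathcal S\subseteq\mathbb K^n$ an $h$-dimensional dominant eigenspace of $B$ if it has an orthonormal basis $s_1,\dots,s_h$ with $Bs_i=\lambda_i(B)s_i$ for $1\le i\le h$. Let $$\mathcal B=\{B\in\mathbb K^{n\times n}: B=B^*,\ \lambda_h(B)>\lambda_{h+1}(B)\}.$$ Let $\|\cdot\|$ be any unitarily invariant norm on $\mathbb K^{n\times n}$, that is, a norm with $\|UAV\|=\|A\|$ for all $A$ and all unitary (orthogonal, if $\mathbb K=\mathbb R$) $U,V$. For $h$-dimensional subspaces $\mathcal S,\mathcal T\subseteq\mathbb K^n$ let $\theta_1\le\dots\le\theta_h$ in $[0,\pi/2]$ be their principal angles, given by $\cos\theta_i=\sigma_i(S^*T)$, where $\sigma_1\ge\dots\ge\sigma_h$ are the singular values and the columns of $S$ and of $T$ are orthonormal bases of $\mathcal S$ and of $\mathcal T$. Put $\|\sin\Theta(\mathcal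 S,\mathcal T)\|=\|\mathrm{diag}(\sin\theta_1,\dots,\sin\theta_h,0,\dots,0)\|$, the norm of an $n\times n$ matrix. Then every $B\in\mathcal B$ has exactly one $h$-dimensional dominant eigenspace $g(B)=\mathcal X_h(B)$, and for every $B\in\mathcal B$ the condition number of $g$ at $B$ satisfies $$\kappa[g](B):=\lim_{\epsilon\to0^+}\ \sup_{\substack{C\in\mathcal B\\0<\|B-C\|<\epsilon}}\frac{\|\sin\Theta(\mathcal X_h(B),\mathcal X_h(C))\|}{\|B-C\|}\ \le\ \frac1{\lambda_h(B)-\lambda_{h+1}(B)},$$ where the limit exists. -/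

import Mathlib

open Filter Topology
open scoped ENNReal Matrix

noncomputable section

namespace DominantEigenspace

variable {𝕜 : Type*} [RCLike 𝕜] {n : ℕ}

/-- `N` is a unitarily invariant norm on `n × n` matrices: a definite seminorm (hence a norm) with
`N (U A V) = N A` for all unitary (orthogonal, if `𝕜 = ℝ`) matrices `U`, `V`. -/
structure IsUnitarilyInvariantNorm (N : Seminorm 𝕜 (Matrix (Fin n) (Fin n) 𝕜)) : Prop where
  eq_zero_of_map_eq_zero : ∀ A, N A = 0 → A = 0
  map_unitary_mul_mul_unitary : ∀ U ∈ Matrix.unitaryGroup (Fin n) 𝕜,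
    ∀ V ∈ Matrix.unitaryGroup (Fin n) 𝕜, ∀ A, N (U * A * V) = N A

/-- The eigenvalue `λ_i(A)` of a Hermitian matrix, for `1 ≤ i ≤ n`: the eigenvalues are counted
with multiplicity, arranged in non-increasing order, and numbered from `1`. -/
def eigenvalue {A : Matrix (Fin n) (Fin n) 𝕜} (hA : A.IsHermitian) (i : ℕ) : ℝ :=
  if hi : i - 1 < n then
    (Matrix.isSymmetric_toEuclideanLin_iff.mpr hA).eigenvalues finrank_euclideanSpace_fin ⟨i - 1, hi⟩
  else 0

/-- An orthonormal basis `x_1, …, x_n` of `𝕜ⁿ` with `A x_i = λ_i(A) x_i`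
(here the index set is `Fin n`, so that `x_i` is the member with index `i - 1`). -/
def eigenbasis {A : Matrix (Fin n) (Fin n) 𝕜} (hA : A.IsHermitian) :
    OrthonormalBasis (Fin n) 𝕜 (EuclideanSpace 𝕜 (Fin n)) :=
  (Matrix.isSymmetric_toEuclideanLin_iff.mpr hA).eigenvectorBasis finrank_euclideanSpace_fin

/-- `S` is an `h`-dimensional dominant eigenspace of `A`: it has an orthonormal basis
`s_1, …, s_h` with `A s_i = λ_i(A) s_i` (so that `dim S = h`). -/
def IsDominantEigenspace {A : Matrix (Fin n) (Fin n) 𝕜} (hA : A.IsHermitian) (h : ℕ)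
    (S : Submodule 𝕜 (EuclideanSpace 𝕜 (Fin n))) : Prop :=
  ∃ s : OrthonormalBasis (Fin h) 𝕜 S, ∀ i : Fin h,
    Matrix.toEuclideanLin A (s i : EuclideanSpace 𝕜 (Fin n)) =
      ((eigenvalue hA (i + 1) : ℝ) : 𝕜) • (s i : EuclideanSpace 𝕜 (Fin n))

/-- The Grassmannian of `h`-dimensional subspaces of `𝕜ⁿ`. -/
abbrev Grassmannian (𝕜 : Type*) [RCLike 𝕜] (n h : ℕ) : Type _ :=
  {S : Submodule 𝕜 (EuclideanSpace 𝕜 (Fin n)) // Module.finrank 𝕜 S = h}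

/-- The cosine `σ_i(S^* T)` of the `i`-th principal angle of two subspaces (numbered from `0`):
`S^* T` is, in orthonormal bases of the two subspaces, the matrix of the restriction to `T`
of the orthogonal projection onto `S`. -/
def principalCos (S T : Submodule 𝕜 (EuclideanSpace 𝕜 (Fin n))) (i : ℕ) : ℝ :=
  LinearMap.singularValues (𝕜 := 𝕜) (E := T) (F := S)
    (S.orthogonalProjectionOnto ∘L T.subtypeL).toLinearMap i

/-- The `i`-th principal angle, for `i < dim S ≤ dim T` (numbered from `0`); it lies
in `[0, π / 2]`, and the angles are non-decreasing in `i`. -/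
def principalAngle (S T : Submodule 𝕜 (EuclideanSpace 𝕜 (Fin n))) (i : ℕ) : ℝ :=
  Real.arccos (principalCos S T i)

/-- `sin Θ(S, T) = diag (sin θ_1, …, sin θ_s)` with `s = dim S ≤ dim T`, completed by zeros to
an `n × n` matrix, so that a norm on `n × n` matrices applies to it. -/
def sinTheta (S T : Submodule 𝕜 (EuclideanSpace 𝕜 (Fin n))) : Matrix (Fin n) (Fin n) 𝕜 :=
  Matrix.diagonal fun i =>
    if (i : ℕ) < Module.finrank 𝕜 S then ((Real.sin (principalAngle S T i) : ℝ) : 𝕜) else 0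

/-- The Hermitian matrices `B` with `λ_h(B) > λ_{h+1}(B)`. -/
def gapSet (𝕜 : Type*) [RCLike 𝕜] (n h : ℕ) : Set (Matrix (Fin n) (Fin n) 𝕜) :=
  {B | ∃ hB : B.IsHermitian, eigenvalue hB h > eigenvalue hB (h + 1)}

theorem finrank_span_eigenbasis {A : Matrix (Fin n) (Fin n) 𝕜} (hA : A.IsHermitian) {h : ℕ}
    (hh : h ≤ n) :
    Module.finrank 𝕜
      (Submodule.span 𝕜 (Set.range fun i : Fin h => eigenbasis hA (Fin.castLE hh i))) = h := by
  have hli := (eigenbasis hA).orthonormal.linearIndependent.comp _ (Fin.castLE_injective hh)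
  simpa [Function.comp_def] using finrank_span_eq_card hli

/-- The map `g` that sends `B` to `X_h(B) = span {x_1, …, x_h}`. -/
def dominantEigenspace {h : ℕ} (hh : h ≤ n) (B : gapSet 𝕜 n h) : Grassmannian 𝕜 n h :=
  ⟨Submodule.span 𝕜 (Set.range fun i : Fin h => eigenbasis B.2.fst (Fin.castLE hh i)),
    finrank_span_eigenbasis B.2.fst hh⟩

/-- The supremum of `dY (g x) (g y) / dX x y` over all `y` with `0 < dX x y < ε`. -/
def supQuotient {X Y : Type*} (dX : X → X → ℝ) (dY : Y → Y → ℝ) (g : X → Y) (x : X) (ε : ℝ) :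
    ℝ≥0∞ :=
  ⨆ (y : X) (_ : 0 < dX x y ∧ dX x y < ε), ENNReal.ofReal (dY (g x) (g y) / dX x y)

/-- The condition number of `g` at `x` with respect to distances `dX` and `dY`: the limit of
`supQuotient` as `ε → 0+`. -/
def conditionNumber {X Y : Type*} (dX : X → X → ℝ) (dY : Y → Y → ℝ) (g : X → Y) (x : X) : ℝ≥0∞ :=
  limUnder (𝓝[>] (0 : ℝ)) (supQuotient dX dY g x)

/-- The distance `N (B - C)` on the matrices with a gap. -/
def gapDist {h : ℕ} (N : Seminorm 𝕜 (Matrix (Fin n) (Fin n) 𝕜)) (B C : gapSet 𝕜 n h) : ℝ :=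
  N ((B : Matrix (Fin n) (Fin n) 𝕜) - C)

/-- The distance `N (sin Θ(S, T))` on the Grassmannian. -/
def sinThetaDist {h : ℕ} (N : Seminorm 𝕜 (Matrix (Fin n) (Fin n) 𝕜))
    (S T : Grassmannian 𝕜 n h) : ℝ :=
  N (sinTheta S.1 T.1)

end DominantEigenspace

end

/-! The bound is the Davis–Kahan theorem combined with continuity of eigenvalues. Let `x i`, `y j`
be eigenbases of `B`, `C`, and let `S`, `T` be their leading spans. The singular values of `(1 -
P_S) P_T` are the sines of the principal angles, padded by zeros, so `N (sinTheta S T)` is the norm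
of the matrix with entries `⟪x i, y j⟫` for `i > h`, `j ≤ h` (counted from 1) and zeros elsewhere
(`map_sinTheta_eq`).

On that block `⟪x i, (B - C) (y j)⟫ = (λ_i(B) - λ_j(C)) ⟪x i, y j⟫`, a Sylvester equation whose two
spectra lie on opposite sides of a gap of width `λ_h(C) - λ_{h+1}(B)`. Hence this width times `N
(sinTheta S T)` is at most `N (B - C)` (`sylvester_le`).

By a Weyl inequality the width is at least `λ_h(B) - λ_{h+1}(B) - K * N (B - C)`. The constant `K`
is crude, but it disappears in the limit. -/

namespace DominantEigenspace

/-! ### Unitarily invariant norms: diagonal multipliers and the Sylvester equation -/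

section

/-- The cube `[-r, r]^ι` is the convex hull of its vertices, and a convex function on a convex hull
is dominated by its value at some generating point. -/
theorem le_of_convexOn_of_signs {ι : Type*} [Finite ι] {g : (ι → ℝ) → ℝ}
    (hg : ConvexOn ℝ Set.univ g) {r c : ℝ}
    (hs : ∀ s : ι → ℝ, (∀ i, s i = 1 ∨ s i = -1) → g (r • s) ≤ c)
    {d : ι → ℝ} (hd : ∀ i, |d i| ≤ r) : g d ≤ c := by
  have hmem : d ∈ convexHull ℝ (Set.univ.pi fun _ : ι => ({-r, r} : Set ℝ)) := by
    refine mem_convexHull_pi fun i _ => ?_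
    have hi := abs_le.mp (hd i)
    rw [convexHull_pair, segment_eq_Icc (by linarith)]
    exact hi
  obtain ⟨y, hy, hle⟩ := (hg.subset (Set.subset_univ _)
    (convex_convexHull ℝ _)).exists_ge_of_mem_convexHull (subset_convexHull ℝ _) hmem
  refine hle.trans ?_
  have hy' : ∀ i, y i = -r ∨ y i = r := fun i => by simpa using hy i trivial
  choose! s hs' using fun i => (show ∃ t : ℝ, (t = 1 ∨ t = -1) ∧ y i = r * t from
    (hy' i).elim (fun h => ⟨-1, Or.inr rfl, by simp [h]⟩) fun h => ⟨1, Or.inl rfl, by simp [h]⟩)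
  have : y = r • s := funext fun i => (hs' i).2
  rw [this]
  exact hs s fun i => (hs' i).1

variable {𝕜 : Type*} [RCLike 𝕜] {n : ℕ}

/-- The diagonal matrix with real entries `d`. -/
def realDiagonal (𝕜 : Type*) [RCLike 𝕜] {n : ℕ} (d : Fin n → ℝ) : Matrix (Fin n) (Fin n) 𝕜 :=
  Matrix.diagonal fun i => (d i : 𝕜)

theorem realDiagonal_add (d e : Fin n → ℝ) :
    realDiagonal 𝕜 (d + e) = realDiagonal 𝕜 d + realDiagonal 𝕜 e := by
  simp [realDiagonal, Matrix.diagonal_add]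

theorem realDiagonal_smul (r : ℝ) (d : Fin n → ℝ) :
    realDiagonal 𝕜 (r • d) = (r : 𝕜) • realDiagonal 𝕜 d := by
  simp [realDiagonal, ← Matrix.diagonal_smul, Pi.smul_def]

theorem realDiagonal_mem_unitaryGroup {s : Fin n → ℝ} (hs : ∀ i, s i = 1 ∨ s i = -1) :
    realDiagonal 𝕜 s ∈ Matrix.unitaryGroup (Fin n) 𝕜 := by
  rw [Matrix.mem_unitaryGroup_iff, realDiagonal, Matrix.star_eq_conjTranspose,
    Matrix.diagonal_conjTranspose, Matrix.diagonal_mul_diagonal, ← Matrix.diagonal_one]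
  congr 1
  funext i
  rcases hs i with h | h <;> simp [h]

theorem convexOn_seminorm_comp (N : Seminorm 𝕜 (Matrix (Fin n) (Fin n) 𝕜))
    {f : (Fin n → ℝ) → Matrix (Fin n) (Fin n) 𝕜} (hadd : ∀ d e, f (d + e) = f d + f e)
    (hsmul : ∀ (r : ℝ) d, f (r • d) = (r : 𝕜) • f d) :
    ConvexOn ℝ Set.univ fun d => N (f d) := by
  refine ⟨convex_univ, fun d _ e _ a b ha hb _ => ?_⟩
  simp only [hadd, hsmul]
  refine (map_add_le_add N _ _).trans ?_
  rw [map_smul_eq_mul, map_smul_eq_mul, RCLike.norm_of_nonneg ha, RCLike.norm_of_nonneg hb]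
  rfl

variable {N : Seminorm 𝕜 (Matrix (Fin n) (Fin n) 𝕜)}

/-- At a vertex of the cube the multiplier is `r` times a diagonal sign matrix, which is unitary;
convexity of the norm covers the remaining `d`. -/
theorem IsUnitarilyInvariantNorm.map_realDiagonal_mul_le (hN : IsUnitarilyInvariantNorm N)
    {d : Fin n → ℝ} {r : ℝ} (hr : 0 ≤ r) (hd : ∀ i, |d i| ≤ r) (M : Matrix (Fin n) (Fin n) 𝕜) :
    N (realDiagonal 𝕜 d * M) ≤ r * N M := by
  refine le_of_convexOn_of_signs (g := fun d => N (realDiagonal 𝕜 d * M))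
    (convexOn_seminorm_comp N (fun d e => by rw [realDiagonal_add, add_mul])
      fun r d => by rw [realDiagonal_smul, smul_mul_assoc]) (fun s hs => ?_) hd
  have := hN.map_unitary_mul_mul_unitary _ (realDiagonal_mem_unitaryGroup hs) 1 (one_mem _) M
  rw [mul_one] at this
  rw [realDiagonal_smul, smul_mul_assoc, map_smul_eq_mul, this, RCLike.norm_of_nonneg hr]

theorem IsUnitarilyInvariantNorm.map_mul_realDiagonal_le (hN : IsUnitarilyInvariantNorm N)
    {d : Fin n → ℝ} {r : ℝ} (hr : 0 ≤ r) (hd : ∀ i, |d i| ≤ r) (M : Matrix (Fin n) (Fin n) 𝕜) :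
    N (M * realDiagonal 𝕜 d) ≤ r * N M := by
  refine le_of_convexOn_of_signs (g := fun d => N (M * realDiagonal 𝕜 d))
    (convexOn_seminorm_comp N (fun d e => by rw [realDiagonal_add, mul_add])
      fun r d => by rw [realDiagonal_smul, mul_smul_comm]) (fun s hs => ?_) hd
  have := hN.map_unitary_mul_mul_unitary 1 (one_mem _) _ (realDiagonal_mem_unitaryGroup hs) M
  rw [one_mul] at this
  rw [realDiagonal_smul, mul_smul_comm, map_smul_eq_mul, this, RCLike.norm_of_nonneg hr]

/-- The norm of the solution of a diagonal Sylvester equation whose two spectra are separated. -/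
theorem IsUnitarilyInvariantNorm.sylvester_le (hN : IsUnitarilyInvariantNorm N)
    {Y F : Matrix (Fin n) (Fin n) 𝕜} {p q : Fin n → Prop} {l m : Fin n → ℝ} {a b : ℝ} (hab : a < b)
    (hl : ∀ i, p i → l i ≤ a) (hm : ∀ j, q j → b ≤ m j)
    (hY : ∀ i j, ¬ (p i ∧ q j) → Y i j = 0)
    (hF : ∀ i j, p i → q j → F i j = ((l i : 𝕜) - (m j : 𝕜)) * Y i j) :
    (b - a) * N Y ≤ N F := by
  classical
  -- The shift `c = a - ρ` puts `l i - c` in `[0, ρ]` on `p` and `m j - c` above `ρ + (b - a)` on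
  -- `q`.
  obtain ⟨ρ, hρ0, hρ⟩ : ∃ ρ : ℝ, 0 ≤ ρ ∧ ∀ i, a - ρ ≤ l i := by
    refine ⟨∑ i, |a - l i|, Finset.sum_nonneg fun _ _ => abs_nonneg _, fun i => ?_⟩
    have h1 := Finset.single_le_sum (f := fun i => |a - l i|) (fun _ _ => abs_nonneg _)
      (Finset.mem_univ i)
    have h2 := le_abs_self (a - l i)
    linarith
  set c := a - ρ with hc
  have hpos : 0 < ρ + (b - a) := by linarith
  let d₁ : Fin n → ℝ := fun i => if p i then l i - c else 0
  let d₂ : Fin n → ℝ := fun j => if q j then (m j - c)⁻¹ else 0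
  let d₃ : Fin n → ℝ := fun i => if p i then 1 else 0
  have hd₁ : ∀ i, |d₁ i| ≤ ρ := fun i => by
    by_cases h : p i
    · have := hl i h
      have := hρ i
      simp only [d₁, h, if_true, abs_le]
      constructor <;> linarith
    · simpa [d₁, h] using hρ0
  have hd₂ : ∀ j, |d₂ j| ≤ (ρ + (b - a))⁻¹ := fun j => by
    by_cases h : q j
    · have := hm j h
      have h3 : ρ + (b - a) ≤ m j - c := by linarith
      simp only [d₂, h, if_true]
      rw [abs_of_nonneg (inv_nonneg.mpr (hpos.le.trans h3))]
      exact inv_anti₀ hpos h3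
    · simpa [d₂, h] using hpos.le
  have hd₃ : ∀ i, |d₃ i| ≤ 1 := fun i => by
    by_cases h : p i <;> simp [d₃, h]
  -- On the block the equation reads `(m j - c) Y i j = (l i - c) Y i j - F i j`. Dividing by `m j -
  -- c` makes `Y` a fixed point of an affine map with contraction factor `ρ / (ρ + (b - a))`; `d₃`
  -- discards the rows of `F` outside `p`.
  have key : Y = realDiagonal 𝕜 d₁ * Y * realDiagonal 𝕜 d₂
      - realDiagonal 𝕜 d₃ * F * realDiagonal 𝕜 d₂ := by
    ext i j
    simp only [realDiagonal, Matrix.sub_apply, Matrix.mul_diagonal, Matrix.diagonal_mul]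
    by_cases hpq : p i ∧ q j
    · have hne : ((m j : 𝕜) - (c : 𝕜)) ≠ 0 := by
        have := hm j hpq.2
        rw [← RCLike.ofReal_sub]
        exact RCLike.ofReal_ne_zero.mpr (by linarith)
      simp only [d₁, d₂, d₃, hpq.1, hpq.2, if_true, hF i j hpq.1 hpq.2]
      push_cast
      field_simp
      ring
    · rw [hY i j hpq]
      rcases not_and_or.mp hpq with h | h <;> simp [d₂, d₃, h]
  have h1 : N Y ≤ (ρ + (b - a))⁻¹ * (ρ * N Y) + (ρ + (b - a))⁻¹ * (1 * N F) := by
    conv_lhs => rw [key]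
    refine (map_sub_le_add N _ _).trans (add_le_add ?_ ?_)
    · refine (hN.map_mul_realDiagonal_le (inv_nonneg.mpr hpos.le) hd₂ _).trans ?_
      gcongr
      exact hN.map_realDiagonal_mul_le hρ0 hd₁ _
    · refine (hN.map_mul_realDiagonal_le (inv_nonneg.mpr hpos.le) hd₂ _).trans ?_
      gcongr
      exact hN.map_realDiagonal_mul_le zero_le_one hd₃ _
  rw [← mul_add, ← div_eq_inv_mul, le_div_iff₀ hpos] at h1
  linarith

/-- A matrix entry is bounded by a multiple of a unitarily invariant norm. -/
theorem IsUnitarilyInvariantNorm.exists_norm_apply_le (hN : IsUnitarilyInvariantNorm N)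
    (i j : Fin n) : ∃ K, 0 ≤ K ∧ ∀ A, ‖A i j‖ ≤ K * N A := by
  have hpos : 0 < N (Matrix.single i j (1 : 𝕜)) := by
    refine (apply_nonneg N _).lt_of_ne' fun h => ?_
    simpa using congrFun₂ (hN.eq_zero_of_map_eq_zero _ h) i j
  refine ⟨(N (Matrix.single i j 1))⁻¹, inv_nonneg.mpr hpos.le, fun A => ?_⟩
  rw [← div_eq_inv_mul, le_div_iff₀ hpos, ← map_smul_eq_mul]
  have habs : ∀ k l : Fin n, |(Pi.single k 1 : Fin n → ℝ) l| ≤ 1 := fun k l => by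
    by_cases h : l = k <;> simp [h]
  -- Coordinate projections on both sides isolate one entry, and neither increases the norm.
  have : A i j • Matrix.single i j (1 : 𝕜)
      = realDiagonal 𝕜 (Pi.single i 1) * A * realDiagonal 𝕜 (Pi.single j 1) := by
    ext k l
    simp only [realDiagonal, Matrix.mul_diagonal, Matrix.diagonal_mul, Matrix.smul_apply,
      Matrix.single_apply, Pi.single_apply]
    by_cases hk : k = i <;> by_cases hl : l = j <;> simp [hk, hl, Ne.symm]
  rw [this]
  refine (hN.map_mul_realDiagonal_le zero_le_one (habs j) _).trans ?_
  rw [one_mul]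
  simpa using hN.map_realDiagonal_mul_le zero_le_one (habs i) A

theorem IsUnitarilyInvariantNorm.exists_norm_inner_le (hN : IsUnitarilyInvariantNorm N) :
    ∃ K, 0 ≤ K ∧ ∀ A, ∀ v : EuclideanSpace 𝕜 (Fin n),
      ‖inner 𝕜 v (Matrix.toEuclideanLin A v)‖ ≤ K * N A * ‖v‖ ^ 2 := by
  choose K hK0 hK using hN.exists_norm_apply_le
  refine ⟨∑ i, ∑ j, K i j, Finset.sum_nonneg fun i _ => Finset.sum_nonneg fun j _ => hK0 i j,
    fun A v => ?_⟩
  have : inner 𝕜 v (Matrix.toEuclideanLin A v) = ∑ i, ∑ j, A i j * v j * star (v i) := by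
    simp [PiLp.inner_apply, Matrix.mulVec, dotProduct, Finset.sum_mul]
  rw [this, Finset.sum_mul, Finset.sum_mul]
  refine norm_sum_le_of_le _ fun i _ => ?_
  rw [Finset.sum_mul, Finset.sum_mul]
  refine norm_sum_le_of_le _ fun j _ => ?_
  rw [norm_mul, norm_mul, norm_star, mul_assoc, sq]
  have h1 := PiLp.norm_apply_le v i
  have h2 := PiLp.norm_apply_le v j
  exact mul_le_mul (hK i j A) (mul_le_mul h2 h1 (norm_nonneg _) (norm_nonneg _)) (by positivity)
    (mul_nonneg (hK0 i j) (apply_nonneg N A))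

end

/-! ### The sines of the principal angles as singular values of `(1 - P_S) P_T` -/

section

variable {𝕜 : Type*} [RCLike 𝕜] {n : ℕ} {N : Seminorm 𝕜 (Matrix (Fin n) (Fin n) 𝕜)}

theorem toMatrix_apply_eq_inner (u v : OrthonormalBasis (Fin n) 𝕜 (EuclideanSpace 𝕜 (Fin n)))
    (A : EuclideanSpace 𝕜 (Fin n) →ₗ[𝕜] EuclideanSpace 𝕜 (Fin n)) (i j : Fin n) :
    LinearMap.toMatrix v.toBasis u.toBasis A i j = inner 𝕜 (u i) (A (v j)) := by
  simp [LinearMap.toMatrix_apply, OrthonormalBasis.repr_apply_apply]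

theorem IsUnitarilyInvariantNorm.map_toMatrix_eq (hN : IsUnitarilyInvariantNorm N)
    (u v u' v' : OrthonormalBasis (Fin n) 𝕜 (EuclideanSpace 𝕜 (Fin n)))
    (A : EuclideanSpace 𝕜 (Fin n) →ₗ[𝕜] EuclideanSpace 𝕜 (Fin n)) :
    N (LinearMap.toMatrix v.toBasis u.toBasis A) =
      N (LinearMap.toMatrix v'.toBasis u'.toBasis A) := by
  rw [← basis_toMatrix_mul_linearMap_toMatrix_mul_basis_toMatrix v.toBasis v'.toBasis u.toBasis
    u'.toBasis A]
  refine hN.map_unitary_mul_mul_unitary _ ?_ _ ?_ _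
  · exact u.toMatrix_orthonormalBasis_mem_unitary u'
  · exact v'.toMatrix_orthonormalBasis_mem_unitary v

theorem toMatrix_basisFun_toEuclideanLin (A : Matrix (Fin n) (Fin n) 𝕜) :
    LinearMap.toMatrix (EuclideanSpace.basisFun (Fin n) 𝕜).toBasis
      (EuclideanSpace.basisFun (Fin n) 𝕜).toBasis (Matrix.toEuclideanLin A) = A := by
  ext i j
  simp [toMatrix_apply_eq_inner, EuclideanSpace.inner_single_left]

/-- A linear map that sends an orthonormal basis to orthogonal vectors of lengths `s i` has the
same norm as the diagonal matrix with entries `s i`. -/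
theorem IsUnitarilyInvariantNorm.map_toMatrix_eq_realDiagonal (hN : IsUnitarilyInvariantNorm N)
    (u v w : OrthonormalBasis (Fin n) 𝕜 (EuclideanSpace 𝕜 (Fin n)))
    (A : EuclideanSpace 𝕜 (Fin n) →ₗ[𝕜] EuclideanSpace 𝕜 (Fin n)) {s : Fin n → ℝ}
    (hA : ∀ i j, inner 𝕜 (A (w i)) (A (w j)) = if i = j then ((s i : 𝕜)) ^ 2 else 0) :
    N (LinearMap.toMatrix v.toBasis u.toBasis A) = N (realDiagonal 𝕜 s) := by
  -- The nonzero images, normalised, form part of an orthonormal basis `b`; in the bases `w` and `b`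
  -- the map is diagonal.
  obtain ⟨b, hb⟩ : ∃ b : OrthonormalBasis (Fin n) 𝕜 (EuclideanSpace 𝕜 (Fin n)),
      ∀ i ∈ {i | s i ≠ 0}, b i = (s i : 𝕜)⁻¹ • A (w i) := by
    refine Orthonormal.exists_orthonormalBasis_extension_of_card_eq (by simp) ?_
    rw [orthonormal_iff_ite]
    rintro ⟨i, hi⟩ ⟨j, hj⟩
    have hi' : (s i : 𝕜) ≠ 0 := RCLike.ofReal_ne_zero.mpr hi
    by_cases h : i = j
    · subst h
      rw [if_pos rfl]
      change inner 𝕜 ((s i : 𝕜)⁻¹ • A (w i)) ((s i : 𝕜)⁻¹ • A (w i)) = 1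
      rw [inner_smul_left, inner_smul_right, hA, if_pos rfl, map_inv₀, RCLike.conj_ofReal]
      field_simp
    · simp [Set.domRestrict, inner_smul_left, inner_smul_right, hA, h]
  have hAw : ∀ i, A (w i) = (s i : 𝕜) • b i := fun i => by
    by_cases h : s i = 0
    · have := hA i i
      rw [if_pos rfl, h, RCLike.ofReal_zero, zero_pow two_ne_zero, inner_self_eq_zero] at this
      rw [this, h, RCLike.ofReal_zero, zero_smul]
    · rw [hb i h, smul_smul, mul_inv_cancel₀ (RCLike.ofReal_ne_zero.mpr h), one_smul]
  rw [hN.map_toMatrix_eq u v b w A]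
  congr 1
  ext i j
  rw [toMatrix_apply_eq_inner, hAw, inner_smul_right, orthonormal_iff_ite.mp b.orthonormal,
    realDiagonal, Matrix.diagonal_apply]
  split_ifs with h
  · rw [h, mul_one]
  · rw [mul_zero]

/-- The product `(1 - P_S) P_T` of orthogonal projections. -/
noncomputable def residualProjection (S T : Submodule 𝕜 (EuclideanSpace 𝕜 (Fin n))) :
    EuclideanSpace 𝕜 (Fin n) →ₗ[𝕜] EuclideanSpace 𝕜 (Fin n) :=
  (Sᗮ.starProjection ∘L T.starProjection).toLinearMap

/-- Polarised Pythagoras; it turns cosines into sines. -/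
theorem inner_residualProjection_of_mem {S T : Submodule 𝕜 (EuclideanSpace 𝕜 (Fin n))}
    {x y : EuclideanSpace 𝕜 (Fin n)} (hx : x ∈ T) (hy : y ∈ T) :
    inner 𝕜 (residualProjection S T x) (residualProjection S T y) =
      inner 𝕜 x y - inner 𝕜 (S.starProjection x) (S.starProjection y) := by
  simp only [residualProjection, ContinuousLinearMap.coe_coe, ContinuousLinearMap.comp_apply,
    Submodule.starProjection_eq_self_iff.mpr hx, Submodule.starProjection_eq_self_iff.mpr hy]
  rw [Submodule.inner_starProjection_left_eq_right,
    Submodule.starProjection_eq_self_iff.mpr (Submodule.starProjection_apply_mem _ _),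
    Submodule.inner_starProjection_left_eq_right S,
    Submodule.starProjection_eq_self_iff.mpr (Submodule.starProjection_apply_mem S _),
    Submodule.starProjection_orthogonal_val, inner_sub_right]

theorem eq_sum_inner_smul_of_mem {k : ℕ} {T : Submodule 𝕜 (EuclideanSpace 𝕜 (Fin n))}
    (e : OrthonormalBasis (Fin k) 𝕜 T) {x : EuclideanSpace 𝕜 (Fin n)} (hx : x ∈ T) :
    x = ∑ j, inner 𝕜 (e j) (⟨x, hx⟩ : T) • (e j : EuclideanSpace 𝕜 (Fin n)) := by
  conv_lhs => rw [show x = T.subtype ⟨x, hx⟩ from rfl, ← e.sum_repr' ⟨x, hx⟩, map_sum]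
  simp only [map_smul, Submodule.subtype_apply]

/-- An orthonormal basis of a subspace extends to an orthonormal basis of the whole space. -/
theorem exists_orthonormalBasis_extending {k : ℕ} (hkn : k ≤ n)
    {T : Submodule 𝕜 (EuclideanSpace 𝕜 (Fin n))} (e : OrthonormalBasis (Fin k) 𝕜 T) :
    ∃ w : OrthonormalBasis (Fin n) 𝕜 (EuclideanSpace 𝕜 (Fin n)),
      (∀ i : Fin k, w (Fin.castLE hkn i) = e i) ∧ ∀ i : Fin n, ¬ (i : ℕ) < k → w i ∈ Tᗮ := by
  obtain ⟨w, hw⟩ : ∃ w : OrthonormalBasis (Fin n) 𝕜 (EuclideanSpace 𝕜 (Fin n)),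
      ∀ i ∈ {i : Fin n | (i : ℕ) < k}, w i =
        if h : (i : ℕ) < k then (e ⟨i, h⟩ : EuclideanSpace 𝕜 (Fin n)) else 0 := by
    refine Orthonormal.exists_orthonormalBasis_extension_of_card_eq (by simp) ?_
    rw [orthonormal_iff_ite]
    rintro ⟨i, hi⟩ ⟨j, hj⟩
    simp only [Set.mem_ofPred_eq] at hi hj
    simp only [Set.domRestrict, hi, hj, dif_pos, ← Submodule.coe_inner]
    rw [orthonormal_iff_ite.mp e.orthonormal]
    simp [Fin.ext_iff]
  have hwe : ∀ i : Fin k, w (Fin.castLE hkn i) = e i := fun i => by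
    rw [hw _ (by simp)]; simp
  refine ⟨w, hwe, fun i hi => ?_⟩
  rw [Submodule.mem_orthogonal]
  intro x hx
  rw [eq_sum_inner_smul_of_mem e hx, sum_inner]
  refine Finset.sum_eq_zero fun j _ => ?_
  rw [inner_smul_left, ← hwe, orthonormal_iff_ite.mp w.orthonormal, if_neg, mul_zero]
  rintro rfl
  exact hi (by simp)

theorem residualProjection_eq_zero {S T : Submodule 𝕜 (EuclideanSpace 𝕜 (Fin n))}
    {x : EuclideanSpace 𝕜 (Fin n)} (hx : x ∈ Tᗮ) : residualProjection S T x = 0 := by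
  simp only [residualProjection, ContinuousLinearMap.coe_coe, ContinuousLinearMap.comp_apply,
    (Submodule.starProjection_apply_eq_zero_iff (K := T)).mpr hx, map_zero]

/-- Right singular vectors. -/
theorem _root_.LinearMap.exists_orthonormalBasis_inner_apply_eq {E F : Type*}
    [NormedAddCommGroup E] [InnerProductSpace 𝕜 E] [FiniteDimensional 𝕜 E]
    [NormedAddCommGroup F] [InnerProductSpace 𝕜 F] [FiniteDimensional 𝕜 F]
    (L : E →ₗ[𝕜] F) {k : ℕ} (hk : Module.finrank 𝕜 E = k) :
    ∃ e : OrthonormalBasis (Fin k) 𝕜 E, ∀ i j, inner 𝕜 (L (e i)) (L (e j)) =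
      if i = j then ((L.singularValues i : ℝ) : 𝕜) ^ 2 else 0 := by
  refine ⟨L.isSymmetric_adjoint_comp_self.eigenvectorBasis hk, fun i j => ?_⟩
  rw [← LinearMap.adjoint_inner_right, ← LinearMap.comp_apply,
    LinearMap.IsSymmetric.apply_eigenvectorBasis, inner_smul_right,
    orthonormal_iff_ite.mp (OrthonormalBasis.orthonormal _), ← L.sq_singularValues_fin]
  split_ifs with h <;> simp [h]

/-- The right singular vectors of `P_S` restricted to `T` have images under `P_S` that are
orthogonal with lengths `cos θ_i`. By Pythagoras their residuals are orthogonal too, with squared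
lengths `1 - cos² θ_i`. -/
theorem exists_principal_basis (S T : Submodule 𝕜 (EuclideanSpace 𝕜 (Fin n))) {k : ℕ}
    (hk : Module.finrank 𝕜 T = k) :
    ∃ e : OrthonormalBasis (Fin k) 𝕜 T, ∀ i j,
      inner 𝕜 (residualProjection S T (e i)) (residualProjection S T (e j)) =
        if i = j then ((Real.sin (principalAngle S T i) : ℝ) : 𝕜) ^ 2 else 0 := by
  obtain ⟨e, he⟩ := LinearMap.exists_orthonormalBasis_inner_apply_eq
    (𝕜 := 𝕜) (E := T) (F := S) (S.orthogonalProjectionOnto ∘L T.subtypeL).toLinearMap hk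
  have hres : ∀ i j : Fin k, inner 𝕜 (residualProjection S T (e i)) (residualProjection S T (e j))
      = if i = j then 1 - ((principalCos S T i : ℝ) : 𝕜) ^ 2 else 0 := fun i j => by
    rw [inner_residualProjection_of_mem (e i).2 (e j).2, ← Submodule.coe_inner,
      orthonormal_iff_ite.mp e.orthonormal]
    have h1 := he i j
    rw [Submodule.coe_inner] at h1
    simp only [ContinuousLinearMap.coe_coe, ContinuousLinearMap.comp_apply,
      Submodule.subtypeL_apply, Submodule.coe_orthogonalProjectionOnto_apply] at h1
    rw [h1]
    split_ifs
    · rfl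
    · exact sub_zero _
  refine ⟨e, fun i j => ?_⟩
  rw [hres]
  refine if_congr Iff.rfl ?_ rfl
  -- As a squared length this is nonnegative, so the square root in `sin (arccos x)` is not
  -- truncated.
  have hnn : 0 ≤ 1 - principalCos S T i ^ 2 := by
    have h1 := inner_self_nonneg (𝕜 := 𝕜) (x := residualProjection S T (e i))
    rw [hres, if_pos rfl] at h1
    exact_mod_cast h1
  have hs : Real.sin (principalAngle S T i) ^ 2 = 1 - principalCos S T i ^ 2 := by
    rw [principalAngle, Real.sin_arccos, Real.sq_sqrt hnn]
  exact_mod_cast (congrArg (RCLike.ofReal (K := 𝕜)) hs).symm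

/-- A principal basis of `T` is completed by vectors of `Tᗮ`, which the residual kills; these
account for the zero padding. Equal dimensions are needed because the padding in `sinTheta` starts
at `dim S`. -/
theorem IsUnitarilyInvariantNorm.map_sinTheta_eq (hN : IsUnitarilyInvariantNorm N)
    {S T : Submodule 𝕜 (EuclideanSpace 𝕜 (Fin n))}
    (hST : Module.finrank 𝕜 S = Module.finrank 𝕜 T)
    (u v : OrthonormalBasis (Fin n) 𝕜 (EuclideanSpace 𝕜 (Fin n))) :
    N (sinTheta S T) = N (LinearMap.toMatrix v.toBasis u.toBasis (residualProjection S T)) := by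
  obtain ⟨k, hk⟩ : ∃ k, Module.finrank 𝕜 T = k := ⟨_, rfl⟩
  have hkn : k ≤ n := by simpa [hk] using Submodule.finrank_le T
  obtain ⟨e, he⟩ := exists_principal_basis S T hk
  obtain ⟨w, hwe, hw⟩ := exists_orthonormalBasis_extending hkn e
  rw [hN.map_toMatrix_eq_realDiagonal u v w _
    (s := fun i => if (i : ℕ) < k then Real.sin (principalAngle S T i) else 0)]
  · congr 1
    simp only [sinTheta, realDiagonal, hST, hk, apply_ite (RCLike.ofReal (K := 𝕜)),
      RCLike.ofReal_zero]
  · intro i j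
    by_cases hi : (i : ℕ) < k
    · by_cases hj : (j : ℕ) < k
      · have h1 := he ⟨i, hi⟩ ⟨j, hj⟩
        rw [← hwe, ← hwe] at h1
        simpa [hi, Fin.ext_iff] using h1
      · rw [residualProjection_eq_zero (hw j hj), inner_zero_right,
          if_neg (by rintro rfl; exact hj hi)]
    · rw [residualProjection_eq_zero (hw i hi), inner_zero_left]
      simp [hi]

end

/-! ### Ordered eigenvalues and the quadratic form -/

section

variable {𝕜 : Type*} [RCLike 𝕜] {n : ℕ} {N : Seminorm 𝕜 (Matrix (Fin n) (Fin n) 𝕜)}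
  {A : Matrix (Fin n) (Fin n) 𝕜}

theorem eigenvalue_succ (hA : A.IsHermitian) (i : Fin n) :
    eigenvalue hA (i + 1) = (Matrix.isSymmetric_toEuclideanLin_iff.mpr hA).eigenvalues
      finrank_euclideanSpace_fin i := by
  simp [eigenvalue]

theorem eigenvalue_succ_le (hA : A.IsHermitian) {i j : ℕ} (hij : i ≤ j) (hj : j < n) :
    eigenvalue hA (j + 1) ≤ eigenvalue hA (i + 1) := by
  rw [eigenvalue_succ hA ⟨j, hj⟩, eigenvalue_succ hA ⟨i, hij.trans_lt hj⟩]
  exact (Matrix.isSymmetric_toEuclideanLin_iff.mpr hA).eigenvalues_antitone _ hij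

theorem eigenvalue_le (hA : A.IsHermitian) {i j : ℕ} (hi : 1 ≤ i) (hij : i ≤ j) (hj : j ≤ n) :
    eigenvalue hA j ≤ eigenvalue hA i := by
  obtain ⟨i, rfl⟩ := Nat.exists_eq_add_of_le' hi
  obtain ⟨j, rfl⟩ := Nat.exists_eq_add_of_le' (hi.trans hij)
  exact eigenvalue_succ_le hA (by omega) (by omega)

theorem toEuclideanLin_eigenbasis (hA : A.IsHermitian) (i : Fin n) :
    Matrix.toEuclideanLin A (eigenbasis hA i) =
      ((eigenvalue hA (i + 1) : ℝ) : 𝕜) • eigenbasis hA i := by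
  rw [eigenvalue_succ]
  exact LinearMap.IsSymmetric.apply_eigenvectorBasis _ _ i

theorem inner_eigenbasis_toEuclideanLin (hA : A.IsHermitian) (i : Fin n)
    (v : EuclideanSpace 𝕜 (Fin n)) :
    inner 𝕜 (eigenbasis hA i) (Matrix.toEuclideanLin A v) =
      ((eigenvalue hA (i + 1) : ℝ) : 𝕜) * inner 𝕜 (eigenbasis hA i) v := by
  rw [← Matrix.isSymmetric_toEuclideanLin_iff.mpr hA, toEuclideanLin_eigenbasis, inner_smul_left,
    RCLike.conj_ofReal]

theorem re_inner_toEuclideanLin (hA : A.IsHermitian) (v : EuclideanSpace 𝕜 (Fin n)) :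
    RCLike.re (inner 𝕜 v (Matrix.toEuclideanLin A v)) =
      ∑ i : Fin n, eigenvalue hA (i + 1) * ‖inner 𝕜 (eigenbasis hA i) v‖ ^ 2 := by
  rw [← (eigenbasis hA).sum_inner_mul_inner, map_sum]
  refine Finset.sum_congr rfl fun i _ => ?_
  rw [inner_eigenbasis_toEuclideanLin, mul_left_comm, RCLike.re_ofReal_mul,
    inner_mul_symm_re_eq_norm, norm_mul, norm_inner_symm v, sq]

end

/-! ### Leading eigenspaces, Davis–Kahan, Weyl, and existence of the limit -/

section

variable {𝕜 : Type*} [RCLike 𝕜] {n h : ℕ} {N : Seminorm 𝕜 (Matrix (Fin n) (Fin n) 𝕜)}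
  {A B C : Matrix (Fin n) (Fin n) 𝕜}

/-- The span of the first `h` members of `eigenbasis hA`. -/
noncomputable def leadingSpan (hA : A.IsHermitian) (hh : h ≤ n) :
    Submodule 𝕜 (EuclideanSpace 𝕜 (Fin n)) :=
  Submodule.span 𝕜 (Set.range fun i : Fin h => eigenbasis hA (Fin.castLE hh i))

theorem eigenbasis_mem_leadingSpan (hA : A.IsHermitian) (hh : h ≤ n) {i : Fin n}
    (hi : (i : ℕ) < h) : eigenbasis hA i ∈ leadingSpan hA hh :=
  Submodule.subset_span ⟨⟨i, hi⟩, rfl⟩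

theorem eigenbasis_mem_leadingSpan_orthogonal (hA : A.IsHermitian) (hh : h ≤ n) {i : Fin n}
    (hi : ¬ (i : ℕ) < h) : eigenbasis hA i ∈ (leadingSpan hA hh)ᗮ := by
  rw [Submodule.mem_orthogonal]
  intro x hx
  induction hx using Submodule.span_induction with
  | mem x hx =>
    obtain ⟨j, rfl⟩ := hx
    refine (eigenbasis hA).orthonormal.inner_eq_zero ?_
    rintro rfl
    exact hi j.2
  | zero => exact inner_zero_left _
  | add x y _ _ hx hy => rw [inner_add_left, hx, hy, add_zero]
  | smul c x _ hx => rw [inner_smul_left, hx, mul_zero]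

theorem mem_leadingSpan_iff (hA : A.IsHermitian) (hh : h ≤ n) {v : EuclideanSpace 𝕜 (Fin n)} :
    v ∈ leadingSpan hA hh ↔ ∀ i : Fin n, ¬ (i : ℕ) < h → inner 𝕜 (eigenbasis hA i) v = 0 := by
  refine ⟨fun hv i hi => Submodule.inner_left_of_mem_orthogonal hv
    (eigenbasis_mem_leadingSpan_orthogonal hA hh hi), fun hv => ?_⟩
  rw [← (eigenbasis hA).sum_repr' v]
  refine Submodule.sum_mem _ fun i _ => ?_
  by_cases hi : (i : ℕ) < h
  · exact Submodule.smul_mem _ _ (eigenbasis_mem_leadingSpan hA hh hi)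
  · rw [hv i hi, zero_smul]
    exact Submodule.zero_mem _

theorem isDominantEigenspace_leadingSpan (hA : A.IsHermitian) (hh : h ≤ n) :
    IsDominantEigenspace hA h (leadingSpan hA hh) := by
  let s : Fin h → leadingSpan hA hh := fun i =>
    ⟨eigenbasis hA (Fin.castLE hh i), eigenbasis_mem_leadingSpan hA hh i.2⟩
  have hs : Orthonormal 𝕜 s := by
    rw [orthonormal_iff_ite]
    intro i j
    rw [Submodule.coe_inner, orthonormal_iff_ite.mp (eigenbasis hA).orthonormal]
    simp [Fin.ext_iff]
  refine ⟨OrthonormalBasis.mk hs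
    (hs.linearIndependent.span_eq_top_of_card_eq_finrank' ?_).ge, fun i => ?_⟩
  · rw [Fintype.card_fin]
    exact (finrank_span_eigenbasis hA hh).symm
  · rw [OrthonormalBasis.coe_mk]
    exact toEuclideanLin_eigenbasis hA (Fin.castLE hh i)

/-- Eigenvectors for `λ_1, …, λ_h` are orthogonal to the eigenbasis vectors with strictly smaller
eigenvalues, so `S` lies in the leading span; the dimensions agree. -/
theorem isDominantEigenspace_iff (hA : A.IsHermitian) (h_lt : h < n)
    (hgap : eigenvalue hA (h + 1) < eigenvalue hA h)
    (S : Submodule 𝕜 (EuclideanSpace 𝕜 (Fin n))) :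
    IsDominantEigenspace hA h S ↔ S = leadingSpan hA h_lt.le := by
  refine ⟨fun ⟨s, hs⟩ => ?_, fun hS => hS ▸ isDominantEigenspace_leadingSpan hA h_lt.le⟩
  refine Submodule.eq_of_le_of_finrank_eq (fun x hx => ?_) ?_
  · rw [eq_sum_inner_smul_of_mem s hx]
    refine Submodule.sum_mem _ fun j _ => Submodule.smul_mem _ _ ?_
    rw [mem_leadingSpan_iff]
    intro i hi
    have h1 := inner_eigenbasis_toEuclideanLin hA i (s j)
    rw [hs, inner_smul_right, ← sub_eq_zero, ← sub_mul, mul_eq_zero, ← RCLike.ofReal_sub,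
      RCLike.ofReal_eq_zero] at h1
    refine h1.resolve_left ?_
    have h2 := eigenvalue_le hA (i := j + 1) (j := h) (by omega) (by omega) h_lt.le
    have h3 := eigenvalue_le hA (i := h + 1) (j := i + 1) (by omega) (by omega) (by omega)
    linarith
  · rw [Module.finrank_eq_card_basis s.toBasis, Fintype.card_fin]
    exact (finrank_span_eigenbasis hA h_lt.le).symm

/-- The Davis–Kahan `sin Θ` theorem for leading eigenspaces. -/
theorem IsUnitarilyInvariantNorm.map_sinTheta_leadingSpan_le (hN : IsUnitarilyInvariantNorm N)
    (hB : B.IsHermitian) (hC : C.IsHermitian) (h_lt : h < n)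
    (hgap : eigenvalue hB (h + 1) < eigenvalue hC h) :
    (eigenvalue hC h - eigenvalue hB (h + 1)) *
      N (sinTheta (leadingSpan hB h_lt.le) (leadingSpan hC h_lt.le)) ≤ N (B - C) := by
  have hfin : Module.finrank 𝕜 (leadingSpan hB h_lt.le) =
      Module.finrank 𝕜 (leadingSpan hC h_lt.le) :=
    (finrank_span_eigenbasis hB h_lt.le).trans (finrank_span_eigenbasis hC h_lt.le).symm
  rw [hN.map_sinTheta_eq hfin (eigenbasis hB) (eigenbasis hC)]
  conv_rhs => rw [← toMatrix_basisFun_toEuclideanLin (B - C),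
    hN.map_toMatrix_eq _ _ (eigenbasis hB) (eigenbasis hC)]
  -- Self-adjointness moves one projection onto each eigenvector, where it acts as the identity or
  -- as zero.
  have hres : ∀ i j, inner 𝕜 (eigenbasis hB i)
      (residualProjection (leadingSpan hB h_lt.le) (leadingSpan hC h_lt.le) (eigenbasis hC j)) =
      inner 𝕜 ((leadingSpan hB h_lt.le)ᗮ.starProjection (eigenbasis hB i))
        ((leadingSpan hC h_lt.le).starProjection (eigenbasis hC j)) := fun i j =>
    (Submodule.inner_starProjection_left_eq_right _ _ _).symm
  refine hN.sylvester_le (p := fun i => ¬ (i : ℕ) < h) (q := fun j => (j : ℕ) < h)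
    (l := fun i => eigenvalue hB (i + 1)) (m := fun j => eigenvalue hC (j + 1)) hgap
    (fun i hi => eigenvalue_le hB (by omega) (by omega) (by omega))
    (fun j hj => eigenvalue_le hC (by omega) (by omega) h_lt.le) (fun i j hij => ?_)
    (fun i j hi hj => ?_)
  · rw [toMatrix_apply_eq_inner, hres]
    rcases not_and_or.mp hij with hi | hj
    · rw [(Submodule.starProjection_apply_eq_zero_iff
        (K := (leadingSpan hB h_lt.le)ᗮ)).mpr, inner_zero_left]
      exact Submodule.le_orthogonal_orthogonal _
        (eigenbasis_mem_leadingSpan hB h_lt.le (not_not.mp hi))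
    · rw [(Submodule.starProjection_apply_eq_zero_iff (K := leadingSpan hC h_lt.le)).mpr
        (eigenbasis_mem_leadingSpan_orthogonal hC h_lt.le hj), inner_zero_right]
  · rw [toMatrix_apply_eq_inner, toMatrix_apply_eq_inner, hres,
      Submodule.starProjection_eq_self_iff.mpr
        (eigenbasis_mem_leadingSpan_orthogonal hB h_lt.le hi),
      Submodule.starProjection_eq_self_iff.mpr (eigenbasis_mem_leadingSpan hC h_lt.le hj),
      map_sub, LinearMap.sub_apply, inner_sub_right, inner_eigenbasis_toEuclideanLin,
      toEuclideanLin_eigenbasis, inner_smul_right, sub_mul]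

/-- Weyl's perturbation inequality, with the constant that compares a unitarily invariant norm
to the numerical radius. -/
theorem IsUnitarilyInvariantNorm.exists_eigenvalue_sub_le (hN : IsUnitarilyInvariantNorm N)
    (h_pos : 1 ≤ h) (h_le : h ≤ n) : ∃ K, 0 ≤ K ∧ ∀ {B C : Matrix (Fin n) (Fin n) 𝕜}
      (hB : B.IsHermitian) (hC : C.IsHermitian),
      eigenvalue hB h - eigenvalue hC h ≤ K * N (B - C) := by
  obtain ⟨K, hK0, hK⟩ := hN.exists_norm_inner_le
  refine ⟨K, hK0, fun {B C} hB hC => ?_⟩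
  -- Courant–Fischer: the `n - h` conditions from `B` and the `h - 1` from `C` number `n - 1`, so a
  -- nonzero vector meets them all.
  obtain ⟨v, hv0, hvB, hvC⟩ : ∃ v : EuclideanSpace 𝕜 (Fin n), v ≠ 0 ∧
      (∀ i : Fin n, ¬ (i : ℕ) < h → inner 𝕜 (eigenbasis hB i) v = 0) ∧
      ∀ i : Fin n, (i : ℕ) + 1 < h → inner 𝕜 (eigenbasis hC i) v = 0 := by
    -- The slot `h - 1` carries no condition and is filled by zero; `f` then misses the constant
    -- vector `1`, and equal dimensions rule out injectivity.
    let f : EuclideanSpace 𝕜 (Fin n) →ₗ[𝕜] (Fin n → 𝕜) := LinearMap.pi fun i =>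
      if (i : ℕ) + 1 < h then innerₛₗ 𝕜 (eigenbasis hC i)
      else if (i : ℕ) < h then 0 else innerₛₗ 𝕜 (eigenbasis hB i)
    have hf : ¬ Function.Injective f := by
      rw [LinearMap.injective_iff_surjective_of_finrank_eq_finrank (by simp)]
      intro hsurj
      obtain ⟨v, hv⟩ := hsurj 1
      have h1 := congrFun hv ⟨h - 1, by omega⟩
      have h2 : ¬ (h - 1 + 1 < h) := by omega
      have h3 : h - 1 < h := by omega
      simp only [f, LinearMap.pi_apply, h2, h3, if_true, if_false, LinearMap.zero_apply,
        Pi.one_apply] at h1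
      exact zero_ne_one h1
    rw [injective_iff_map_eq_zero] at hf
    push Not at hf
    obtain ⟨v, hv, hv0⟩ := hf
    refine ⟨v, hv0, fun i hi => ?_, fun i hi => ?_⟩
    · have h1 := congrFun hv i
      have h2 : ¬ ((i : ℕ) + 1 < h) := by omega
      simpa [f, h2, hi] using h1
    · have h1 := congrFun hv i
      simpa [f, hi] using h1
  have h1 : eigenvalue hB h * ‖v‖ ^ 2 ≤ RCLike.re (inner 𝕜 v (Matrix.toEuclideanLin B v)) := by
    rw [re_inner_toEuclideanLin hB, ← (eigenbasis hB).sum_sq_norm_inner_right, Finset.mul_sum]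
    refine Finset.sum_le_sum fun i _ => ?_
    by_cases hi : (i : ℕ) < h
    · gcongr
      exact eigenvalue_le hB (by omega) (by omega) h_le
    · simp [hvB i hi]
  have h2 : RCLike.re (inner 𝕜 v (Matrix.toEuclideanLin C v)) ≤ eigenvalue hC h * ‖v‖ ^ 2 := by
    rw [re_inner_toEuclideanLin hC, ← (eigenbasis hC).sum_sq_norm_inner_right, Finset.mul_sum]
    refine Finset.sum_le_sum fun i _ => ?_
    by_cases hi : (i : ℕ) + 1 < h
    · simp [hvC i hi]
    · gcongr
      exact eigenvalue_le hC (by omega) (by omega) (by omega)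
  have h3 := (RCLike.re_le_norm _).trans (hK (B - C) v)
  rw [map_sub, LinearMap.sub_apply, inner_sub_right, map_sub] at h3
  have hv : 0 < ‖v‖ ^ 2 := by positivity
  refine le_of_mul_le_mul_right ?_ hv
  linarith

theorem monotone_supQuotient {X Y : Type*} (dX : X → X → ℝ) (dY : Y → Y → ℝ) (g : X → Y) (x : X) :
    Monotone (supQuotient dX dY g x) := fun _ _ hab =>
  iSup_mono fun _ => iSup_mono' fun hy => ⟨⟨hy.1, hy.2.trans_le hab⟩, le_rfl⟩

/-- A monotone function into the complete linear order `ℝ≥0∞` has a right limit at `0`, so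
`limUnder` is a genuine limit. -/
theorem tendsto_supQuotient {X Y : Type*} (dX : X → X → ℝ) (dY : Y → Y → ℝ) (g : X → Y) (x : X) :
    Tendsto (supQuotient dX dY g x) (𝓝[>] (0 : ℝ)) (𝓝 (conditionNumber dX dY g x)) :=
  tendsto_nhds_limUnder ⟨_, (monotone_supQuotient dX dY g x).tendsto_nhdsGT 0⟩

end

end DominantEigenspace

theorem mainTheorem5 {𝕜 : Type*} [RCLike 𝕜] {n h : ℕ} (h_pos : 1 ≤ h) (h_lt : h < n)
    (N : Seminorm 𝕜 (Matrix (Fin n) (Fin n) 𝕜))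
    (hN : DominantEigenspace.IsUnitarilyInvariantNorm N)
    (B : DominantEigenspace.gapSet 𝕜 n h) :
    -- every matrix with a gap has exactly one `h`-dimensional dominant eigenspace, the value of `g`
    (∀ C : DominantEigenspace.gapSet 𝕜 n h, ∀ S : Submodule 𝕜 (EuclideanSpace 𝕜 (Fin n)),
      DominantEigenspace.IsDominantEigenspace C.2.fst h S ↔
        S = (DominantEigenspace.dominantEigenspace h_lt.le C).1) ∧
    -- the limit that defines the condition number exists
    Tendsto
      (DominantEigenspace.supQuotient (DominantEigenspace.gapDist N)
        (DominantEigenspace.sinThetaDist N) (DominantEigenspace.dominantEigenspace h_lt.le) B)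
      (𝓝[>] (0 : ℝ))
      (𝓝 (DominantEigenspace.conditionNumber (DominantEigenspace.gapDist N)
        (DominantEigenspace.sinThetaDist N) (DominantEigenspace.dominantEigenspace h_lt.le) B)) ∧
    DominantEigenspace.conditionNumber (DominantEigenspace.gapDist N)
        (DominantEigenspace.sinThetaDist N) (DominantEigenspace.dominantEigenspace h_lt.le) B ≤
      ENNReal.ofReal (1 / (DominantEigenspace.eigenvalue B.2.fst h -
        DominantEigenspace.eigenvalue B.2.fst (h + 1))) := by
  refine ⟨fun C S => DominantEigenspace.isDominantEigenspace_iff C.2.fst h_lt C.2.snd S,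
    DominantEigenspace.tendsto_supQuotient _ _ _ _, ?_⟩
  obtain ⟨K, hK0, hK⟩ := hN.exists_eigenvalue_sub_le h_pos h_lt.le
  set gap := DominantEigenspace.eigenvalue B.2.fst h -
    DominantEigenspace.eigenvalue B.2.fst (h + 1) with hgap
  have hgap_pos : 0 < gap := sub_pos.mpr B.2.snd
  -- `gap - K * ε` bounds `λ_h(C) - λ_{h+1}(B)` from below when `N (B - C) < ε`.
  have hlim : Tendsto (fun ε : ℝ => gap - K * ε) (𝓝[>] 0) (𝓝 gap) := by
    have : Continuous fun ε : ℝ => gap - K * ε := by fun_prop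
    simpa using (this.tendsto 0).mono_left nhdsWithin_le_nhds
  refine le_of_tendsto_of_tendsto (DominantEigenspace.tendsto_supQuotient _ _ _ _)
    (ENNReal.tendsto_ofReal (tendsto_const_nhds.div hlim hgap_pos.ne')) ?_
  -- For small `ε` this bound is positive, which supplies the gap that Davis–Kahan needs and permits
  -- the division.
  filter_upwards [hlim.eventually (lt_mem_nhds hgap_pos)] with ε hε
  refine iSup₂_le fun C hC => ENNReal.ofReal_le_ofReal ?_
  simp only [DominantEigenspace.gapDist] at hC ⊢
  have hev := hK B.2.fst C.2.fst
  have hKε : K * N ((B : Matrix (Fin n) (Fin n) 𝕜) - C) ≤ K * ε := by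
    gcongr
    exact hC.2.le
  have hdk := hN.map_sinTheta_leadingSpan_le B.2.fst C.2.fst h_lt (by linarith)
  rw [Pi.div_apply, div_le_div_iff₀ hC.1 hε, one_mul]
  refine le_trans ?_ hdk
  rw [mul_comm]
  refine mul_le_mul_of_nonneg_right ?_ (apply_nonneg N _)
  linarith
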